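/- All graphs are finite and simple. Let $T=(V,E)$ be a tree. A leaf is a vertex of degree $1$; the height of a vertex is its least distance to a leaf (an isolated vertex has height $0$), $V_k$ is the set of vertices of height $k$, and the height of $T$ is the largest $k$ with $V_k\neq\emptyset$. The tree $T$ is balanced if no two vertices of the same height are adjacent. For $D\subseteq V$ let $N(D)$ be the union of the open neighbourhoods $N(v)$, $v\in D$. The set $D$ is a total dominating set if $N(D)=V$, and $T$ is unmixed if all inclusion-minimal total dominating sets have the same size. Let $V_{even}$ and $V_{odd}$ be the sets of vertices of even and of odd height. An odd-TD-set is a set $D\subseteq V$ with $V_{odd}\subseteq N(D)$. The even-stable complex $\mathcal S_{even}(T)$ is the simplicial complex generated by the sets $V_{even}\setminus D$ with $D$ an inclusion-minimal odd-TD-set. A labelling of $T$ consists of an enumeration $s_1,\dots,s_p$ of $V_1$ (without repetition) and, for every $i$, an enumeration $u_{i,1},\dots,u_{i,k_i}$ of $N(s_i)$ (without repetition, $k_i=|N(s_i)|$) with $u_{i,1}\in V_2$. Given a labelling, let $P_T=\{(a_1,\dots,a_p): 1\le a_i\le k_i \text{ for all } i\}$ and $U_T=\{V_{even}\setminus\{u_{1,a_1},\dots,u_{p,a_p}\}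 : (a_1,\dots,a_p)\in P_T\}$. For $\alpha\in P_T$ let $\ell(\alpha)$ be the number of entries of $\alpha$ equal to $1$, and set $\alpha<_P\beta$ if $\ell(\alpha)>\ell(\beta)$, or $\ell(\alpha)=\ell(\beta)$ and $\alpha$ is lexicographically smaller than $\beta$. A simplicial complex $\Delta$ is pure if all its facets (maximal faces) have the same dimension, where $\dim F=|F|-1$. A shelling of a pure complex $\Delta$ is an ordering $F_1,\dots,F_m$ of its facets such that for all $1<i\le m$ the complex $\langle F_1,\dots,F_{i-1}\rangle\cap\langle F_i\rangle$ is pure of dimension $\dim\Delta-1$. **Theorem.** Let $T$ be an unmixed balanced tree of height $3$. Then $T$ has a labelling, and for every labelling the following hold. The vertices $u_{1,1},\dots,u_{p,1}$ are the elements of $V_2$, each listed once, and for every $i$ the vertices $u_{i,2},\dots,u_{i,k_i}$ are the elements of $N(s_i)\cap V_0$, each listed once. The rule $\nu_T(V_{even}\setminus\{u_{1,a_1},\dots,u_{p,a_p}\})=(a_1,\dots,a_p)$ gives a well-defined bijection $\nu_T:U_T\to P_T$, so that $F<_T F'\iff \nu_T(F)<_P\nu_T(F')$ defines a strict total order $<_T$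 on $U_T$. Every facet of $\mathcal S_{even}(T)$ belongs to $U_T$, and the order $<_T$ restricted to the set of facets is a shelling of $\mathcal S_{even}(T)$ (which in particular is pure and shellable). -/

import Mathlib

namespace EvenStable

/-! ### Simplicial complexes and shellings

A simplicial complex on the vertex set `V` is a family of subsets of `V` that is closed under taking
subsets (the empty face is allowed), that is, an element of `LowerSet (Set V)`; the complex generated
by a family of sets is its `lowerClosure`. -/

section Complexes

variable {V : Type*}

/-- The facets of a complex: its inclusion-maximal faces. -/
def facets (Δ : LowerSet (Set V)) : Set (Set V) :=
  {F | Maximal (fun A => A ∈ Δ) F}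

/-- The dimension `|F| - 1` of a face (so the empty face has dimension `-1`). -/
noncomputable def faceDim (F : Set V) : ℤ := (F.ncard : ℤ) - 1

/-- The dimension of a complex: the maximal dimension of its faces. -/
noncomputable def dim (Δ : LowerSet (Set V)) : ℤ :=
  sSup (faceDim '' (Δ : Set (Set V)))

/-- A complex is pure if all its facets have the same dimension. -/
def IsPure (Δ : LowerSet (Set V)) : Prop :=
  ∀ F ∈ facets Δ, ∀ F' ∈ facets Δ, faceDim F = faceDim F'

/-- `F 0, …, F (m - 1)` is a shelling of `Δ`: the complex `Δ` is pure, the `F i` are its facets, each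
listed once, and for every `i` but the first one the complex
`⟨F 0, …, F (i - 1)⟩ ∩ ⟨F i⟩` is pure of dimension `dim Δ - 1`. -/
def IsShelling (Δ : LowerSet (Set V)) {m : ℕ} (F : Fin m → Set V) : Prop :=
  IsPure Δ ∧ Function.Injective F ∧ Set.range F = facets Δ ∧
    ∀ i : Fin m, 0 < (i : ℕ) →
      IsPure (lowerClosure (F '' Set.Iio i) ⊓ lowerClosure {F i}) ∧
      dim (lowerClosure (F '' Set.Iio i) ⊓ lowerClosure {F i}) = dim Δ - 1

/-- The relation `r`, restricted to the facets of `Δ`, is a (strict, total) order such that listing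
the facets increasingly along `r` gives a shelling of `Δ`. -/
def IsShellingOrder (Δ : LowerSet (Set V)) (r : Set V → Set V → Prop) : Prop :=
  ∃ (m : ℕ) (F : Fin m → Set V), (∀ i j : Fin m, r (F i) (F j) ↔ i < j) ∧ IsShelling Δ F

end Complexes

/-! ### Heights, balanced graphs, total domination -/

section Graphs

variable {V : Type*} (G : SimpleGraph V)

/-- The number of neighbours of a vertex. -/
noncomputable def deg (v : V) : ℕ := (G.neighborSet v).ncard

/-- A leaf is a vertex of degree one. -/
def IsLeaf (v : V) : Prop := deg G v = 1

open Classical in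
/-- The height of a vertex: the least distance to a leaf, and `0` for an isolated vertex. -/
noncomputable def height (v : V) : ℕ :=
  if deg G v = 0 then 0
  else sInf {n | ∃ l, IsLeaf G l ∧ G.Reachable v l ∧ G.dist v l = n}

/-- The set `V_k` of vertices of height `k`. -/
def layer (k : ℕ) : Set V := {v | height G v = k}

/-- The height of a (finite) graph: the largest `k` with `V_k` nonempty. -/
noncomputable def graphHeight : ℕ := sSup {k | (layer G k).Nonempty}

/-- No two vertices of the same height are adjacent. -/
def IsBalanced : Prop := ∀ u v, G.Adj u v → height G u ≠ height G v

/-- The vertices of even height. -/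
def evenPart : Set V := {v | Even (height G v)}

/-- The vertices of odd height. -/
def oddPart : Set V := {v | Odd (height G v)}

/-- The open neighbourhood `N(D)`, the union of the neighbourhoods of the vertices in `D`. -/
def nbhd (D : Set V) : Set V := ⋃ v ∈ D, G.neighborSet v

/-- `D` is a total dominating set. -/
def IsTDSet (D : Set V) : Prop := nbhd G D = Set.univ

/-- `D` is an `S`-totally dominating set. -/
def IsSTDSet (S D : Set V) : Prop := S ⊆ nbhd G D

/-- All minimal total dominating sets have the same size. -/
def IsUnmixed : Prop :=
  ∀ D D' : Set V, Minimal (IsTDSet G) D → Minimal (IsTDSet G) D' → D.ncard = D'.ncard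

/-- The even-stable complex, generated by the complements in the even part of the minimal
odd-total-dominating sets. -/
def evenStableComplex : LowerSet (Set V) :=
  lowerClosure {F | ∃ D, Minimal (IsSTDSet G (oddPart G)) D ∧ F = evenPart G \ D}

/-- The number `p` of vertices of height one. -/
noncomputable def numSupport : ℕ := (layer G 1).ncard

/-- A labelling: an enumeration `s_1, …, s_p` of the vertices of height one and, for every `i`, an
enumeration `u_{i,1}, …, u_{i,k_i}` (without repetition) of the neighbours of `s_i`, starting with a
vertex of height two. Here `k_i` is the degree of `s_i`; the values `u i j` for `j` outside
`{1, …, k_i}` play no role. -/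
structure Labelling where
  s : Fin (numSupport G) → V
  u : Fin (numSupport G) → ℕ → V
  s_bijOn : Set.BijOn s Set.univ (layer G 1)
  u_bijOn : ∀ i, Set.BijOn (u i) (Set.Icc 1 (deg G (s i))) (G.neighborSet (s i))
  u_one : ∀ i, u i 1 ∈ layer G 2

end Graphs

/-! ### The order on vectors and on the sets `U_T` -/

/-- The number of entries of a vector that are equal to `1`. -/
def numOnes {p : ℕ} (a : Fin p → ℕ) : ℕ := (Finset.univ.filter fun i => a i = 1).card

/-- Vectors with more entries equal to `1` come first; ties are broken lexicographically. -/
def vecLT {p : ℕ} (a b : Fin p → ℕ) : Prop :=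
  numOnes b < numOnes a ∨ (numOnes a = numOnes b ∧ toLex a < toLex b)

namespace Labelling

variable {V : Type*} {G : SimpleGraph V} (L : Labelling G)

/-- The set `P_T` of vectors `(a_1, …, a_p)` with `1 ≤ a_i ≤ k_i`. -/
def vectors : Set (Fin (numSupport G) → ℕ) :=
  {a | ∀ i, 1 ≤ a i ∧ a i ≤ deg G (L.s i)}

/-- The set `V_even \ {u_{1,a_1}, …, u_{p,a_p}}`. -/
def compl (a : Fin (numSupport G) → ℕ) : Set V :=
  evenPart G \ Set.range fun i => L.u i (a i)

/-- The family `U_T` of all the sets `V_even \ {u_{1,a_1}, …, u_{p,a_p}}`. -/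
def complSets : Set (Set V) := L.compl '' L.vectors

/-- The map `ν_T` from `U_T` to `P_T`, sending `V_even \ {u_{1,a_1}, …, u_{p,a_p}}` to
`(a_1, …, a_p)`. -/
noncomputable def nu (F : Set V) : Fin (numSupport G) → ℕ :=
  Function.invFunOn L.compl L.vectors F

/-- The order `<_T` on `U_T`, transported from the order on vectors. -/
def setLT (F F' : Set V) : Prop := vecLT (L.nu F) (L.nu F')

end Labelling

end EvenStable

namespace EvenStable

/-! ### Distances from a root in a tree: parents and children. -/

section Rooted

variable {V : Type*} {T : SimpleGraph V}

/-! Adjacent heights differ by exactly one, so odd vertices are dominated only by even ones and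
conversely. The union of a minimal odd-TD-set and a minimal set dominating the even part is a
minimal total dominating set; fixing the second shows that all minimal odd-TD-sets have one size
(`ncard_eq_of_minimal`).

This size rigidity determines the structure near `V_1`. Exchange arguments in the rooted tree show
that neighbourhoods of height-one vertices are disjoint (`lower_unique`), that the common size is `p
= |V_1|` (`ncard_of_minimal`), and that each `s_i` has only one neighbour of height two
(`upper_unique`). Hence a minimal odd-TD-set picks exactly one neighbour of each `s_i`, and the
facets are the sets `L.compl a` whose chosen vertices dominate the odd part (`generators_eq`).

For the shelling, an entry `a i ≠ 1` selects a leaf, which dominates only `s_i`; replacing it by any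
other neighbour of `s_i` keeps odd domination (`isSTDSet_update`). If `b` precedes `a`, such a
replacement by `b i` can be made so that the result precedes `a` (`exists_update_vecLT`), which is
the exchange criterion. -/

theorem exists_adj_dist_add_one (hT : T.Connected) (r : V) {z : V} (hz : z ≠ r) :
    ∃ a, T.Adj a z ∧ T.dist r a + 1 = T.dist r z := by
  obtain ⟨p, hp⟩ := hT.exists_walk_length_eq_dist z r
  cases p with
  | nil => exact absurd rfl hz
  | @cons _ a _ h q =>
    refine ⟨a, h.symm, ?_⟩
    have h1 : T.dist a r ≤ q.length := T.dist_le q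
    have h2 := hT.dist_triangle (u := z) (v := a) (w := r)
    have h3 : T.dist z a = 1 := SimpleGraph.dist_eq_one_iff_adj.2 h
    rw [T.dist_comm (u := r), T.dist_comm (u := r)]
    simp only [SimpleGraph.Walk.length_cons] at hp
    omega

/-- Each candidate parent is the second vertex of a geodesic from `z` to `r`, and paths in a tree
are unique. -/
theorem eq_of_adj_of_dist_add_one (hT : T.IsTree) (r : V) {a b z : V} (ha : T.Adj a z)
    (hb : T.Adj b z) (hda : T.dist r a + 1 = T.dist r z) (hdb : T.dist r b + 1 = T.dist r z) :
    a = b := by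
  have key : ∀ c, T.Adj c z → T.dist r c + 1 = T.dist r z →
      ∃ p : T.Walk z r, p.IsPath ∧ p.snd = c := by
    intro c hc hd
    obtain ⟨p, hp⟩ := hT.connected.exists_walk_length_eq_dist c r
    refine ⟨SimpleGraph.Walk.cons hc.symm p, ?_, by simp⟩
    apply SimpleGraph.Walk.isPath_of_length_eq_dist
    rw [SimpleGraph.Walk.length_cons, hp, T.dist_comm, hd, T.dist_comm]
  obtain ⟨p, hp, rfl⟩ := key a ha hda
  obtain ⟨q, hq, rfl⟩ := key b hb hdb
  rw [(hT.existsUnique_path z r).unique hp hq]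

theorem exists_adj_add_one_dist (hT : T.IsTree) (r : V) {x a b : V} (hab : a ≠ b)
    (ha : T.Adj x a) (hb : T.Adj x b) : ∃ z, T.Adj x z ∧ T.dist r x + 1 = T.dist r z := by
  rcases hT.dist_eq_dist_add_one_of_adj r ha with h | h
  · rcases hT.dist_eq_dist_add_one_of_adj r hb with h' | h'
    · exact absurd (eq_of_adj_of_dist_add_one hT r ha.symm hb.symm h.symm h'.symm) hab
    · exact ⟨b, hb, h'.symm⟩
  · exact ⟨a, ha, h.symm⟩

end Rooted

/-! ### Heights in a balanced tree of height three. -/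

section Heights

variable {V : Type*} {G : SimpleGraph V}

theorem height_le_dist (hG : G.Connected) {v l : V} (hl : IsLeaf G l) :
    height G v ≤ G.dist v l := by
  unfold height
  split_ifs
  · exact Nat.zero_le _
  · exact Nat.sInf_le ⟨l, hl, hG v l, rfl⟩

theorem exists_isLeaf_dist_eq_height (hG : G.Connected) {v : V} (hv : deg G v ≠ 0)
    {l₀ : V} (hl₀ : IsLeaf G l₀) : ∃ l, IsLeaf G l ∧ G.dist v l = height G v := by
  have hne : {n | ∃ l, IsLeaf G l ∧ G.Reachable v l ∧ G.dist v l = n}.Nonempty :=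
    ⟨_, l₀, hl₀, hG v l₀, rfl⟩
  obtain ⟨l, hl, -, h⟩ := Nat.sInf_mem hne
  refine ⟨l, hl, ?_⟩
  rw [h, height, if_neg hv]

/-- The features of a balanced tree of height three used below. -/
structure IsBalancedThree (T : SimpleGraph V) : Prop where
  isTree : T.IsTree
  height_le : ∀ v, height T v ≤ 3
  exists_three : ∃ v, height T v = 3
  adj_height : ∀ {u v}, T.Adj u v → height T u = height T v + 1 ∨ height T v = height T u + 1
  leaf_unique : ∀ {v a b}, height T v = 0 → T.Adj v a → T.Adj v b → a = b
  two_adj : ∀ {v}, height T v ≠ 0 → ∃ a b, a ≠ b ∧ T.Adj v a ∧ T.Adj v b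
  exists_adj : ∀ v, ∃ w, T.Adj v w
  exists_lower : ∀ {v}, height T v ≠ 0 → ∃ w, T.Adj v w ∧ height T v = height T w + 1

theorem isBalancedThree [Finite V] {T : SimpleGraph V} (hT : T.IsTree) (hbal : IsBalanced T)
    (hheight : graphHeight T = 3) : IsBalancedThree T := by
  have hfin : {k | (layer T k).Nonempty}.Finite :=
    (Set.finite_range (height T)).subset fun k ⟨v, hv⟩ => ⟨v, hv⟩
  have hle : ∀ v, height T v ≤ 3 := fun v => by
    rw [← hheight]; exact le_csSup hfin.bddAbove ⟨v, rfl⟩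
  have h3 : ∃ v, height T v = 3 := by
    have hne : {k | (layer T k).Nonempty}.Nonempty :=
      ⟨_, hT.connected.nonempty.some, rfl⟩
    have := Nat.sSup_mem hne hfin.bddAbove
    rw [← graphHeight, hheight] at this
    exact this
  obtain ⟨v₀, hv₀⟩ := h3
  have hd0 : deg T v₀ ≠ 0 := fun h => by simp [height, h] at hv₀
  -- Without leaves every height would be `0`, since `sInf ∅ = 0` in `ℕ`.
  obtain ⟨l₀, hl₀⟩ : ∃ l, IsLeaf T l := by
    by_contra! h
    simp [height, h] at hv₀
  have hadj : ∀ v, ∃ w, T.Adj v w := by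
    intro v
    obtain ⟨w₀, hw₀⟩ : ∃ w, T.Adj v₀ w := by
      by_contra! h
      exact hd0 (by simp [deg, SimpleGraph.neighborSet, h])
    by_cases h : v = v₀
    · exact ⟨w₀, h ▸ hw₀⟩
    · obtain ⟨a, ha, -⟩ := exists_adj_dist_add_one hT.connected v₀ h
      exact ⟨a, ha.symm⟩
  have hdeg : ∀ v, deg T v ≠ 0 := fun v h => by
    obtain ⟨w, hw⟩ := hadj v
    rw [deg, Set.ncard_eq_zero (Set.toFinite _)] at h
    exact (h ▸ hw : w ∈ (∅ : Set V))
  have hmin := fun v => exists_isLeaf_dist_eq_height hT.connected (hdeg v) hl₀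
  have hzero : ∀ v, height T v = 0 ↔ IsLeaf T v := by
    intro v
    constructor
    · intro h
      obtain ⟨l, hl, h'⟩ := hmin v
      rw [h, hT.connected.dist_eq_zero_iff] at h'
      exact h' ▸ hl
    · intro h
      have := height_le_dist hT.connected (v := v) h
      simpa using this
  have hlip : ∀ {u v}, T.Adj u v → height T u ≤ height T v + 1 := by
    intro u v h
    obtain ⟨l, hl, h'⟩ := hmin v
    have h1 := height_le_dist hT.connected (v := u) hl
    have h2 := hT.connected.dist_triangle (u := u) (v := v) (w := l)
    have h3 : T.dist u v = 1 := SimpleGraph.dist_eq_one_iff_adj.2 h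
    omega
  refine ⟨hT, hle, ⟨v₀, hv₀⟩, ?_, ?_, ?_, hadj, ?_⟩
  · intro u v h
    have h1 := hlip h
    have h2 := hlip h.symm
    have h3 := hbal u v h
    omega
  · intro v a b h ha hb
    obtain ⟨c, hc⟩ := Set.ncard_eq_one.1 ((hzero v).1 h)
    have ha' : a ∈ T.neighborSet v := ha
    have hb' : b ∈ T.neighborSet v := hb
    rw [hc] at ha' hb'
    exact ha'.trans hb'.symm
  · intro v h
    have h1 : deg T v ≠ 1 := fun h' => h ((hzero v).2 h')
    have h2 := hdeg v
    have : 1 < (T.neighborSet v).ncard := by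
      change 1 < deg T v
      omega
    obtain ⟨a, ha, b, hb, hab⟩ := (Set.one_lt_ncard (Set.toFinite _)).1 this
    exact ⟨a, b, hab, ha, hb⟩
  · intro v h
    obtain ⟨l, hl, h'⟩ := hmin v
    have hvl : v ≠ l := fun e => h ((hzero v).2 (e ▸ hl))
    obtain ⟨a, ha, hd⟩ := exists_adj_dist_add_one hT.connected l hvl
    refine ⟨a, ha.symm, ?_⟩
    have h1 := height_le_dist hT.connected (v := a) hl
    have h2 := hlip ha.symm
    rw [T.dist_comm, T.dist_comm (u := l)] at hd
    omega

end Heights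


/-! ### Minimal dominating sets and private neighbours. -/

section Domination

variable {V : Type*} {G : SimpleGraph V}

theorem mem_nbhd {D : Set V} {v : V} : v ∈ nbhd G D ↔ ∃ u ∈ D, G.Adj u v := by
  simp [nbhd]

theorem IsSTDSet.mono {S D D' : Set V} (h : IsSTDSet G S D) (hD : D ⊆ D') : IsSTDSet G S D' :=
  fun _ hx => let ⟨u, hu, ha⟩ := mem_nbhd.1 (h hx); mem_nbhd.2 ⟨u, hD hu, ha⟩

/-- A vertex of `S` dominated by `d` alone forces `d` into every dominating subset of `D`. -/
theorem IsSTDSet.minimal {S D : Set V} (h : IsSTDSet G S D)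
    (hp : ∀ d ∈ D, ∃ x ∈ S, ∀ u ∈ D, G.Adj u x → u = d) : Minimal (IsSTDSet G S) D := by
  refine ⟨h, fun D' hD' hsub d hd => ?_⟩
  obtain ⟨x, hx, hu⟩ := hp d hd
  obtain ⟨u, huD, hux⟩ := mem_nbhd.1 (hD' hx)
  exact hu u (hsub huD) hux ▸ huD

theorem exists_private {S D : Set V} (h : Minimal (IsSTDSet G S) D) {d : V} (hd : d ∈ D) :
    ∃ x ∈ S, G.Adj d x ∧ ∀ u ∈ D, G.Adj u x → u = d := by
  by_contra! hcon
  have : IsSTDSet G S (D \ {d}) := by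
    intro x hx
    obtain ⟨u, hu, hux⟩ := mem_nbhd.1 (h.1 hx)
    by_cases e : u = d
    · obtain ⟨u', hu', ha, hne⟩ := hcon x hx (e ▸ hux)
      exact mem_nbhd.2 ⟨u', ⟨hu', hne⟩, ha⟩
    · exact mem_nbhd.2 ⟨u, ⟨hu, e⟩, hux⟩
  exact (h.2 this Set.sdiff_subset hd).2 rfl

theorem exists_minimal_subset [Finite V] {S D : Set V} (h : IsSTDSet G S D) :
    ∃ D' ⊆ D, Minimal (IsSTDSet G S) D' :=
  exists_minimal_le_of_wellFoundedLT _ D h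

theorem minimal_isTDSet_iff {D : Set V} :
    Minimal (IsTDSet G) D ↔ Minimal (IsSTDSet G Set.univ) D := by
  have : IsTDSet G = IsSTDSet G Set.univ := by
    funext D
    simp [IsTDSet, IsSTDSet, Set.univ_subset_iff]
  rw [this]

theorem disjoint_parts : Disjoint (evenPart G) (oddPart G) :=
  Set.disjoint_left.2 fun _ h h' => (Nat.not_odd_iff_even.2 h) h'

theorem layer_one_subset : layer G 1 ⊆ oddPart G := fun x (hx : height G x = 1) => by
  simp [oddPart, hx]

end Domination

/-! ### Structure of unmixed balanced trees of height three. -/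

namespace IsBalancedThree

variable {V : Type*} {T : SimpleGraph V} (hT : IsBalancedThree T)
include hT

theorem even_of_adj_odd {u v : V} (h : T.Adj u v) (hv : v ∈ oddPart T) : u ∈ evenPart T := by
  have := hT.adj_height h
  simp only [oddPart, evenPart, Set.mem_ofPred_eq] at *
  grind

theorem odd_of_adj_even {u v : V} (h : T.Adj u v) (hv : v ∈ evenPart T) : u ∈ oddPart T := by
  have := hT.adj_height h
  simp only [oddPart, evenPart, Set.mem_ofPred_eq] at *
  grind

theorem subset_evenPart {D : Set V} (hD : Minimal (IsSTDSet T (oddPart T)) D) :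
    D ⊆ evenPart T := fun _ hd =>
  let ⟨_, hx, ha, _⟩ := exists_private hD hd
  hT.even_of_adj_odd ha hx

theorem subset_oddPart {D : Set V} (hD : Minimal (IsSTDSet T (evenPart T)) D) :
    D ⊆ oddPart T := fun _ hd =>
  let ⟨_, hx, ha, _⟩ := exists_private hD hd
  hT.odd_of_adj_even ha hx

/-- By parity, `A` dominates no odd vertex and `D` no even one, so private neighbours stay private
in the union. -/
theorem minimal_union {D A : Set V} (hD : Minimal (IsSTDSet T (oddPart T)) D)
    (hA : Minimal (IsSTDSet T (evenPart T)) A) : Minimal (IsTDSet T) (D ∪ A) := by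
  have hDe := hT.subset_evenPart hD
  have hAo := hT.subset_oddPart hA
  have hdis : ∀ v, v ∈ evenPart T → v ∉ oddPart T := fun v h =>
    Set.disjoint_left.1 disjoint_parts h
  rw [minimal_isTDSet_iff]
  refine IsSTDSet.minimal ?_ ?_
  · intro x _
    rcases Nat.even_or_odd (height T x) with hx | hx
    · exact hA.1.mono Set.subset_union_right hx
    · exact hD.1.mono Set.subset_union_left hx
  · rintro d (hd | hd)
    · obtain ⟨x, hx, -, hu⟩ := exists_private hD hd
      refine ⟨x, trivial, ?_⟩
      rintro u (huD | huA) hux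
      · exact hu u huD hux
      · exact absurd (hAo huA) (hdis u (hT.even_of_adj_odd hux hx))
    · obtain ⟨x, hx, -, hu⟩ := exists_private hA hd
      refine ⟨x, trivial, ?_⟩
      rintro u (huD | huA) hux
      · exact absurd (hT.odd_of_adj_even hux hx) (hdis u (hDe huD))
      · exact hu u huA hux

theorem ncard_eq_of_minimal [Finite V] (hun : IsUnmixed T) {D D' : Set V}
    (hD : Minimal (IsSTDSet T (oddPart T)) D) (hD' : Minimal (IsSTDSet T (oddPart T)) D') :
    D.ncard = D'.ncard := by
  obtain ⟨A, -, hA⟩ : ∃ A ⊆ Set.univ, Minimal (IsSTDSet T (evenPart T)) A := by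
    apply exists_minimal_subset
    intro x _
    obtain ⟨w, hw⟩ := hT.exists_adj x
    exact mem_nbhd.2 ⟨w, trivial, hw.symm⟩
  have h := hun _ _ (hT.minimal_union hD hA) (hT.minimal_union hD' hA)
  have hAo := hT.subset_oddPart hA
  rw [Set.ncard_union_eq (disjoint_parts.mono (hT.subset_evenPart hD) hAo),
    Set.ncard_union_eq (disjoint_parts.mono (hT.subset_evenPart hD') hAo)] at h
  omega

theorem exists_child (r : V) {x : V} (hx : x ∈ oddPart T) :
    ∃ z, T.Adj x z ∧ T.dist r x + 1 = T.dist r z := by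
  obtain ⟨a, b, hab, ha, hb⟩ := hT.two_adj (v := x) fun h => by simp [oddPart, h] at hx
  exact exists_adj_add_one_dist hT.isTree r hab ha hb

theorem exists_leaf {s : V} (hs : height T s = 1) : ∃ l, T.Adj l s ∧ height T l = 0 := by
  obtain ⟨l, hl, h⟩ := hT.exists_lower (v := s) (by omega)
  exact ⟨l, hl.symm, by omega⟩

/-- In an unmixed tree a vertex of height two has only one neighbour of height one. -/
theorem lower_unique_of_two [Finite V] (hun : IsUnmixed T) {u s s' : V} (hu : height T u = 2)
    (hs : height T s = 1) (hs' : height T s' = 1) (hus : T.Adj u s) (hus' : T.Adj u s') :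
    s = s' := by
  by_contra hne
  have hdu : T.dist u u = 0 := T.dist_self
  have hds : T.dist u s = 1 := SimpleGraph.dist_eq_one_iff_adj.2 hus
  have hds' : T.dist u s' = 1 := SimpleGraph.dist_eq_one_iff_adj.2 hus'
  -- Root at `u` and discard `u` and the children of `s` and `s'`. Children of the other odd
  -- vertices remain, while nothing in `A` touches `s` or `s'`. A minimal `E ⊆ A` is then completed
  -- in two ways: by two leaves, minimally, or by the single vertex `u`. The sizes disagree.
  let A : Set V := {z | z ≠ u ∧ ∀ a, T.Adj a z → T.dist u a + 1 = T.dist u z → a ≠ s ∧ a ≠ s'}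
  have hA : IsSTDSet T (oddPart T \ {s, s'}) A := by
    rintro x ⟨hx, hxs⟩
    obtain ⟨z, hz, hd⟩ := hT.exists_child u hx
    refine mem_nbhd.2 ⟨z, ⟨?_, ?_⟩, hz.symm⟩
    · rintro rfl
      omega
    · intro a ha hda
      obtain rfl := eq_of_adj_of_dist_add_one hT.isTree u ha hz hda hd
      simpa using hxs
  obtain ⟨E, hEA, hE⟩ := exists_minimal_subset hA
  have hnot : ∀ t, (t = s ∨ t = s') → T.Adj u t → ∀ e ∈ E, ¬ T.Adj e t := by
    intro t ht hut e he h
    have hdt : T.dist u t = 1 := SimpleGraph.dist_eq_one_iff_adj.2 hut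
    rcases hT.isTree.dist_eq_dist_add_one_of_adj u h with h1 | h1
    · have := (hEA he).2 t h.symm h1.symm
      tauto
    · exact (hEA he).1 (eq_of_adj_of_dist_add_one hT.isTree u h hut h1.symm (by omega))
  have hEs := hnot s (Or.inl rfl) hus
  have hEs' := hnot s' (Or.inr rfl) hus'
  obtain ⟨l, hl, hl0⟩ := hT.exists_leaf hs
  obtain ⟨l', hl', hl0'⟩ := hT.exists_leaf hs'
  have hll : l ≠ l' := by
    rintro rfl
    exact hne (hT.leaf_unique hl0 hl hl')
  have hso : s ∈ oddPart T := by simp [oddPart, hs]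
  have hso' : s' ∈ oddPart T := by simp [oddPart, hs']
  have hD1 : Minimal (IsSTDSet T (oddPart T)) (insert l (insert l' E)) := by
    refine IsSTDSet.minimal ?_ ?_
    · intro x hx
      by_cases h1 : x = s
      · exact mem_nbhd.2 ⟨l, by simp, h1 ▸ hl⟩
      by_cases h2 : x = s'
      · exact mem_nbhd.2 ⟨l', by simp, h2 ▸ hl'⟩
      refine hE.1.mono ?_ ⟨hx, by simp [h1, h2]⟩
      intro e he
      simp [he]
    · rintro d (rfl | rfl | hd)
      · refine ⟨s, hso, ?_⟩
        rintro v (rfl | rfl | hv) h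
        · rfl
        · exact absurd (hT.leaf_unique hl0' h hl') hne
        · exact absurd h (hEs v hv)
      · refine ⟨s', hso', ?_⟩
        rintro v (rfl | rfl | hv) h
        · exact absurd (hT.leaf_unique hl0 hl h) hne
        · rfl
        · exact absurd h (hEs' v hv)
      · obtain ⟨x, ⟨hx, hxs⟩, -, hp⟩ := exists_private hE hd
        refine ⟨x, hx, ?_⟩
        rintro v (rfl | rfl | hv) h
        · exact absurd (by simp [hT.leaf_unique hl0 h hl]) hxs
        · exact absurd (by simp [hT.leaf_unique hl0' h hl']) hxs
        · exact hp v hv h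
  have hD2 : IsSTDSet T (oddPart T) (insert u E) := by
    intro x hx
    by_cases h1 : x = s
    · exact mem_nbhd.2 ⟨u, by simp, h1 ▸ hus⟩
    by_cases h2 : x = s'
    · exact mem_nbhd.2 ⟨u, by simp, h2 ▸ hus'⟩
    exact hE.1.mono (Set.subset_insert _ _) ⟨hx, by simp [h1, h2]⟩
  obtain ⟨D3, hD3, hmin⟩ := exists_minimal_subset hD2
  have h1 := hT.ncard_eq_of_minimal hun hD1 hmin
  have h2 := Set.ncard_le_ncard hD3 (Set.toFinite _)
  have h3 := Set.ncard_insert_le u E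
  have h4 : l' ∉ E := fun h => hEs' l' h hl'
  have h5 : l ∉ insert l' E := by
    rintro (h | h)
    · exact hll h
    · exact hEs l h hl
  rw [Set.ncard_insert_of_notMem h5, Set.ncard_insert_of_notMem h4] at h1
  omega

theorem lower_unique [Finite V] (hun : IsUnmixed T) {u s s' : V}
    (hs : height T s = 1) (hs' : height T s' = 1) (hus : T.Adj u s) (hus' : T.Adj u s') :
    s = s' := by
  have h := hT.adj_height hus
  by_cases h0 : height T u = 0
  · exact hT.leaf_unique h0 hus hus'
  · exact hT.lower_unique_of_two hun (by omega) hs hs' hus hus'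

/-- No vertex dominates two vertices of height one, so choosing dominators is injective. -/
theorem numSupport_le_ncard [Finite V] (hun : IsUnmixed T) {D : Set V}
    (hD : IsSTDSet T (layer T 1) D) : numSupport T ≤ D.ncard := by
  have : ∀ s ∈ layer T 1, ∃ d ∈ D, T.Adj d s := fun s hs => mem_nbhd.1 (hD hs)
  choose! f hf hfa using this
  refine Set.ncard_le_ncard_of_injOn f hf ?_ (Set.toFinite _)
  intro s hs s' hs' h
  exact hT.lower_unique hun hs hs' (hfa s hs) (h ▸ hfa s' hs')

theorem exists_layer_one : ∃ s, height T s = 1 := by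
  obtain ⟨v, hv⟩ := hT.exists_three
  obtain ⟨w, -, hw⟩ := hT.exists_lower (v := v) (by omega)
  obtain ⟨s, -, hs⟩ := hT.exists_lower (v := w) (by omega)
  exact ⟨s, by omega⟩

/-- The parents of the height-one vertices suffice: below a vertex `x` of height three lies a child
`u` of height two, and below `u` a vertex `s` of height one, whose parent `u` dominates `x`. -/
theorem exists_isSTDSet_ncard_le [Finite V] :
    ∃ D, IsSTDSet T (oddPart T) D ∧ D.ncard ≤ numSupport T := by
  obtain ⟨r, hr⟩ := hT.exists_layer_one
  have : ∀ s, ∃ a, T.Adj a s ∧ (s ≠ r → T.dist r a + 1 = T.dist r s) := by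
    intro s
    by_cases h : s = r
    · obtain ⟨a, ha⟩ := hT.exists_adj s
      exact ⟨a, ha.symm, fun h' => absurd h h'⟩
    · obtain ⟨a, ha, hd⟩ := exists_adj_dist_add_one hT.isTree.connected r h
      exact ⟨a, ha, fun _ => hd⟩
  choose c hc hcd using this
  refine ⟨c '' layer T 1, ?_, Set.ncard_image_le (Set.toFinite _)⟩
  intro x hx
  obtain h1 | h1 : height T x = 1 ∨ height T x = 3 := by
    have h3 := hT.height_le x
    simp only [oddPart, Set.mem_ofPred_eq] at hx
    grind
  · exact mem_nbhd.2 ⟨c x, ⟨x, h1, rfl⟩, hc x⟩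
  · obtain ⟨u, hu, hd⟩ := hT.exists_child r hx
    have hu2 : height T u = 2 := by
      have := hT.adj_height hu
      have := hT.height_le u
      omega
    obtain ⟨s, hs, hs1⟩ := hT.exists_lower (v := u) (by omega)
    have hsd : T.dist r u + 1 = T.dist r s := by
      rcases hT.isTree.dist_eq_dist_add_one_of_adj r hs with h | h
      · have := eq_of_adj_of_dist_add_one hT.isTree r hs.symm hu h.symm hd
        subst this
        omega
      · exact h.symm
    have hsr : s ≠ r := by
      rintro rfl
      simp at hsd
    refine mem_nbhd.2 ⟨c s, ⟨s, by change height T s = 1; omega, rfl⟩, ?_⟩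
    rw [eq_of_adj_of_dist_add_one hT.isTree r (hc s) hs (hcd s hsr) hsd]
    exact hu.symm

theorem ncard_of_minimal [Finite V] (hun : IsUnmixed T) {D : Set V}
    (hD : Minimal (IsSTDSet T (oddPart T)) D) : D.ncard = numSupport T := by
  obtain ⟨D0, h0, hle⟩ := hT.exists_isSTDSet_ncard_le
  obtain ⟨D1, hsub, h1⟩ := exists_minimal_subset h0
  refine le_antisymm ?_ (hT.numSupport_le_ncard hun (layer_one_subset.trans hD.1))
  rw [hT.ncard_eq_of_minimal hun hD h1]
  exact (Set.ncard_le_ncard hsub (Set.toFinite _)).trans hle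

theorem minimal_of_ncard_le [Finite V] (hun : IsUnmixed T) {D : Set V}
    (hD : IsSTDSet T (oddPart T) D) (hle : D.ncard ≤ numSupport T) :
    Minimal (IsSTDSet T (oddPart T)) D := by
  obtain ⟨D1, hsub, h1⟩ := exists_minimal_subset hD
  rw [← hT.ncard_of_minimal hun h1] at hle
  rwa [← Set.eq_of_subset_of_ncard_le hsub hle (Set.toFinite _)]

/-- Deleting one of two dominators of `s` would leave `V_1` dominated by fewer than `p` vertices. -/
theorem eq_of_mem_minimal [Finite V] (hun : IsUnmixed T) {D : Set V}
    (hD : Minimal (IsSTDSet T (oddPart T)) D) {s u u' : V} (hs : height T s = 1)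
    (hu : u ∈ D) (hu' : u' ∈ D) (hus : T.Adj u s) (hus' : T.Adj u' s) : u = u' := by
  by_contra hne
  have h : IsSTDSet T (layer T 1) (D \ {u}) := by
    intro x hx
    by_cases hxs : x = s
    · exact mem_nbhd.2 ⟨u', ⟨hu', fun h => hne h.symm⟩, hxs ▸ hus'⟩
    · obtain ⟨d, hd, hdx⟩ := mem_nbhd.1 (hD.1 (layer_one_subset hx))
      refine mem_nbhd.2 ⟨d, ⟨hd, ?_⟩, hdx⟩
      rintro rfl
      exact hxs (hT.lower_unique hun hx hs hdx hus)
  have h1 := hT.numSupport_le_ncard hun h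
  have h2 := Set.ncard_sdiff_singleton_lt_of_mem hu (Set.toFinite _)
  have h3 := hT.ncard_of_minimal hun hD
  omega

theorem exists_upper [Finite V] (hun : IsUnmixed T) {u : V} (hu : height T u = 2) :
    ∃ w, T.Adj u w ∧ height T w = 3 := by
  obtain ⟨a, b, hab, ha, hb⟩ := hT.two_adj (v := u) (by omega)
  have h1 := hT.adj_height ha
  have h2 := hT.adj_height hb
  by_cases h3 : height T a = 3
  · exact ⟨a, ha, h3⟩
  · refine ⟨b, hb, ?_⟩
    by_contra h4
    exact hab (hT.lower_unique hun (by omega) (by omega) ha hb)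

/-- In an unmixed tree a vertex of height one has only one neighbour of height two. -/
theorem upper_unique [Finite V] (hun : IsUnmixed T) {s u u' : V} (hs : height T s = 1)
    (hu : height T u = 2) (hu' : height T u' = 2) (hus : T.Adj u s) (hus' : T.Adj u' s) :
    u = u' := by
  by_contra hne
  obtain ⟨w, hw, hw3⟩ := hT.exists_upper hun hu
  obtain ⟨w', hw', hw3'⟩ := hT.exists_upper hun hu'
  have dist_two : ∀ {v x}, T.Adj v s → T.Adj v x → height T x = 3 →
      T.dist s v + 1 = T.dist s x := by
    intro v x hv hx hx3
    have h1 : T.dist s v = 1 := SimpleGraph.dist_eq_one_iff_adj.2 hv.symm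
    rcases hT.isTree.dist_eq_dist_add_one_of_adj s hx with h | h
    · have : T.dist s x = 0 := by omega
      rw [hT.isTree.connected.dist_eq_zero_iff] at this
      subst this
      omega
    · exact h.symm
  -- Root at `s`. Children of `w`, `w'` and `s` are discarded, except `u` and `u'`, so `w` and `w'`
  -- can only be dominated by their parents `u` and `u'`. Both must survive in a minimal subset,
  -- although both are adjacent to `s`.
  let D0 : Set V :=
    {z | ∀ a, T.Adj a z → T.dist s a + 1 = T.dist s z → a ≠ w ∧ a ≠ w' ∧ a ≠ s} ∪ {u, u'}
  have hD0 : IsSTDSet T (oddPart T) D0 := by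
    intro x hx
    by_cases h1 : x = w
    · exact mem_nbhd.2 ⟨u, Or.inr (by simp), h1 ▸ hw⟩
    by_cases h2 : x = w'
    · exact mem_nbhd.2 ⟨u', Or.inr (by simp), h2 ▸ hw'⟩
    by_cases h3 : x = s
    · exact mem_nbhd.2 ⟨u, Or.inr (by simp), h3 ▸ hus⟩
    obtain ⟨z, hz, hd⟩ := hT.exists_child s hx
    refine mem_nbhd.2 ⟨z, Or.inl fun a ha hda => ?_, hz.symm⟩
    obtain rfl := eq_of_adj_of_dist_add_one hT.isTree s ha hz hda hd
    exact ⟨h1, h2, h3⟩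
  obtain ⟨D, hsub, hD⟩ := exists_minimal_subset hD0
  have mem : ∀ {v x}, T.Adj v s → T.Adj v x → height T x = 3 → (x = w ∨ x = w') → v ∈ D := by
    intro v x hv hx hx3 hxw
    have hd2 := dist_two hv hx hx3
    obtain ⟨d, hd, hdx⟩ := mem_nbhd.1 (hD.1 (show x ∈ oddPart T by
      simp only [oddPart, Set.mem_ofPred_eq, hx3]; decide))
    suffices d = v from this ▸ hd
    rcases hsub hd with h | h
    · rcases hT.isTree.dist_eq_dist_add_one_of_adj s hdx with h1 | h1
      · have := h x hdx.symm h1.symm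
        tauto
      · exact eq_of_adj_of_dist_add_one hT.isTree s hdx hx h1.symm hd2
    · have hds : T.Adj d s := by
        rcases h with rfl | rfl
        · exact hus
        · exact hus'
      exact eq_of_adj_of_dist_add_one hT.isTree s hdx hx (dist_two hds hdx hx3) hd2
  exact hne (hT.eq_of_mem_minimal hun hD hs (mem hus hw hw3 (Or.inl rfl))
    (mem hus' hw' hw3' (Or.inr rfl)) hus hus')

/-- The next vertex on a geodesic to a vertex of height three cannot be a leaf, since the geodesic
would have to turn back to `s`. -/
theorem exists_two {s : V} (hs : height T s = 1) : ∃ u, T.Adj s u ∧ height T u = 2 := by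
  obtain ⟨r, hr⟩ := hT.exists_three
  have hsr : s ≠ r := by
    rintro rfl
    omega
  obtain ⟨a, ha, hd⟩ := exists_adj_dist_add_one hT.isTree.connected r hsr
  refine ⟨a, ha.symm, ?_⟩
  have h1 := hT.adj_height ha
  by_contra h2
  have har : a ≠ r := by
    rintro rfl
    omega
  obtain ⟨b, hb, hdb⟩ := exists_adj_dist_add_one hT.isTree.connected r har
  have := hT.leaf_unique (by omega) ha hb.symm
  subst this
  omega

end IsBalancedThree


/-! ### Complexes generated by equicardinal sets, and shellings. -/

section Complexes

variable {V : Type*}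

theorem dim_eq {Δ : LowerSet (Set V)} {A : Set V} (hA : A ∈ Δ)
    (h : ∀ B ∈ Δ, B.ncard ≤ A.ncard) : dim Δ = faceDim A := by
  refine IsGreatest.csSup_eq ⟨⟨A, hA, rfl⟩, ?_⟩
  rintro _ ⟨B, hB, rfl⟩
  have := h B hB
  simp only [faceDim]
  omega

variable [Finite V]

theorem facets_lowerClosure {S : Set (Set V)} {n : ℕ} (h : ∀ A ∈ S, A.ncard = n) :
    facets (lowerClosure S) = S := by
  ext F
  constructor
  · rintro ⟨⟨A, hA, hFA⟩, hmax⟩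
    have : A ≤ F := hmax (subset_lowerClosure hA) hFA
    rwa [le_antisymm hFA this]
  · intro hF
    refine ⟨subset_lowerClosure hF, ?_⟩
    rintro B ⟨A, hA, hBA⟩ hFB
    have : F = A := Set.eq_of_subset_of_ncard_le (hFB.trans hBA) (by rw [h A hA, h F hF])
    rw [this]
    exact hBA

theorem isPure_lowerClosure {S : Set (Set V)} {n : ℕ} (h : ∀ A ∈ S, A.ncard = n) :
    IsPure (lowerClosure S) := by
  intro F hF F' hF'
  rw [facets_lowerClosure h] at hF hF'
  simp [faceDim, h F hF, h F' hF']

theorem dim_lowerClosure {S : Set (Set V)} {n : ℕ} (h : ∀ A ∈ S, A.ncard = n)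
    (hS : S.Nonempty) : dim (lowerClosure S) = (n : ℤ) - 1 := by
  obtain ⟨A, hA⟩ := hS
  rw [dim_eq (subset_lowerClosure hA), faceDim, h A hA]
  rintro B ⟨A', hA', hB⟩
  rw [h A hA, ← h A' hA']
  exact Set.ncard_le_ncard hB (Set.toFinite _)

/-- The usual exchange criterion for shellings. -/
theorem isShelling_of_exchange {m n : ℕ} {F : Fin m → Set V} (hinj : Function.Injective F)
    (hcard : ∀ i, (F i).ncard = n)
    (hex : ∀ i j, j < i → ∃ k < i, F j ∩ F i ⊆ F k ∧ (F k ∩ F i).ncard + 1 = n) :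
    IsShelling (lowerClosure (Set.range F)) F := by
  have hr : ∀ A ∈ Set.range F, A.ncard = n := by
    rintro _ ⟨i, rfl⟩
    exact hcard i
  refine ⟨isPure_lowerClosure hr, hinj, (facets_lowerClosure hr).symm, fun i hi => ?_⟩
  -- By exchange, every intersection with an earlier facet lies in one of codimension one, so the
  -- latter generate.
  let S : Set (Set V) := {A | ∃ k < i, A = F k ∩ F i ∧ A.ncard + 1 = n}
  have hS : lowerClosure (F '' Set.Iio i) ⊓ lowerClosure {F i} = lowerClosure S := by
    ext A
    constructor
    · rintro ⟨⟨_, ⟨j, hj, rfl⟩, h1⟩, ⟨_, rfl, h2⟩⟩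
      obtain ⟨k, hk, hsub, hc⟩ := hex i j hj
      have h3 : A ⊆ F j ∩ F i := Set.subset_inter h1 h2
      exact ⟨F k ∩ F i, ⟨k, hk, rfl, hc⟩, Set.subset_inter (h3.trans hsub) h2⟩
    · rintro ⟨_, ⟨k, hk, rfl, -⟩, h⟩
      exact ⟨⟨F k, ⟨k, hk, rfl⟩, h.trans Set.inter_subset_left⟩,
        ⟨F i, rfl, h.trans Set.inter_subset_right⟩⟩
  have hSc : ∀ A ∈ S, A.ncard = n - 1 := by
    rintro A ⟨k, -, -, hc⟩
    omega
  -- The facet `F 0` supplies a member of `S`; this also gives `1 ≤ n`, so `n - 1` is not truncated.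
  obtain ⟨k, hk, -, hc⟩ := hex i ⟨0, by omega⟩ hi
  rw [hS, dim_lowerClosure hSc ⟨_, k, hk, rfl, hc⟩, dim_lowerClosure hr ⟨_, i, rfl⟩]
  refine ⟨isPure_lowerClosure hSc, ?_⟩
  omega

theorem exists_equiv_fin_of_isStrictTotalOrder {α : Type*} [Finite α] (r : α → α → Prop)
    [IsStrictTotalOrder α r] : ∃ (m : ℕ) (e : Fin m ≃ α), ∀ i j, r (e i) (e j) ↔ i < j := by
  classical
  let _ : LinearOrder α := linearOrderOfSTO r
  have : Fintype α := Fintype.ofFinite α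
  let e : Fin (Fintype.card α) ≃o α := Fintype.orderIsoFinOfCardEq α rfl
  exact ⟨_, e.toEquiv, fun i j => e.lt_iff_lt⟩

theorem isShellingOrder_of_exchange {n : ℕ} {S : Set (Set V)} {r : Set V → Set V → Prop}
    [IsStrictTotalOrder S fun A B => r A B] (hcard : ∀ A ∈ S, A.ncard = n)
    (hex : ∀ A ∈ S, ∀ B ∈ S, r B A →
      ∃ C ∈ S, r C A ∧ B ∩ A ⊆ C ∧ (C ∩ A).ncard + 1 = n) :
    IsShellingOrder (lowerClosure S) r := by
  obtain ⟨m, e, he⟩ := exists_equiv_fin_of_isStrictTotalOrder fun A B : S => r A B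
  refine ⟨_, fun i => (e i : Set V), he, ?_⟩
  have hr : S = Set.range fun i => (e i : Set V) := by
    ext A
    exact ⟨fun hA => ⟨e.symm ⟨A, hA⟩, by simp⟩, by rintro ⟨i, rfl⟩; exact (e i).2⟩
  conv in lowerClosure S => rw [hr]
  refine isShelling_of_exchange (n := n) (fun i j h => e.injective (Subtype.ext h))
    (fun i => hcard _ (e i).2) fun i j hji => ?_
  obtain ⟨C, hC, hCA, hsub, hc⟩ := hex _ (e i).2 _ (e j).2 ((he j i).2 hji)
  have hC' : (e (e.symm ⟨C, hC⟩) : Set V) = C := by simp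
  rw [← hC'] at hCA hsub hc
  exact ⟨_, (he _ _).1 hCA, hsub, hc⟩

end Complexes

/-! ### The order on vectors. -/

section Vectors

variable {p : ℕ}

theorem vecLT_irrefl (a : Fin p → ℕ) : ¬ vecLT a a := fun h =>
  h.elim (lt_irrefl _) fun h => lt_irrefl _ h.2

theorem vecLT_trans {a b c : Fin p → ℕ} (h : vecLT a b) (h' : vecLT b c) : vecLT a c := by
  rcases h with h | ⟨h1, h2⟩
  · rcases h' with h' | ⟨h1', -⟩
    · exact Or.inl (h'.trans h)
    · exact Or.inl (h1' ▸ h)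
  · rcases h' with h' | ⟨h1', h2'⟩
    · exact Or.inl (h1 ▸ h')
    · exact Or.inr ⟨h1.trans h1', h2.trans h2'⟩

theorem vecLT_trichotomous (a b : Fin p → ℕ) : vecLT a b ∨ a = b ∨ vecLT b a := by
  rcases lt_trichotomy (numOnes a) (numOnes b) with h | h | h
  · exact Or.inr (Or.inr (Or.inl h))
  · rcases lt_trichotomy (toLex a) (toLex b) with h' | h' | h'
    · exact Or.inl (Or.inr ⟨h, h'⟩)
    · exact Or.inr (Or.inl (toLex.injective h'))
    · exact Or.inr (Or.inr (Or.inr ⟨h.symm, h'⟩))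
  · exact Or.inl (Or.inl h)

/-- If `b` precedes `a`, then some entry of `a` which is not `1` can be replaced by the
corresponding entry of `b` to give a vector preceding `a`. -/
theorem exists_update_vecLT {a b : Fin p → ℕ} (hb : ∀ i, 1 ≤ b i)
    (h : vecLT b a) :
    ∃ i, a i ≠ 1 ∧ a i ≠ b i ∧ vecLT (Function.update a i (b i)) a := by
  by_cases hcase : ∃ i, a i ≠ 1 ∧ b i = 1
  · obtain ⟨i, hai, hbi⟩ := hcase
    refine ⟨i, hai, fun e => hai (e.trans hbi), Or.inl (Finset.card_lt_card ?_)⟩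
    rw [Finset.ssubset_iff_of_subset]
    · exact ⟨i, by simp [hbi], by simp [hai]⟩
    · intro j hj
      by_cases hji : j = i
      · subst hji
        simp [hbi]
      · simpa [Function.update_of_ne hji] using hj
  -- Now the ones of `b` are among those of `a`, so `vecLT b a` forces the same positions of ones;
  -- the first position where they differ works.
  · push Not at hcase
    have hsub : (Finset.univ.filter fun i => b i = 1) ⊆ Finset.univ.filter fun i => a i = 1 := by
      intro i hi
      by_contra h'
      exact hcase i (by simpa using h') (by simpa using hi)
    have hle : numOnes b ≤ numOnes a := Finset.card_le_card hsub
    obtain h | ⟨heq, hlex⟩ := h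
    · omega
    have hfil := Finset.eq_of_subset_of_card_le hsub heq.ge
    have hone : ∀ i, b i = 1 ↔ a i = 1 := fun i => by
      simpa using Finset.ext_iff.1 hfil i
    obtain ⟨i, -, hi⟩ := hlex
    have hi' : b i < a i := hi
    have hai : a i ≠ 1 := by
      have := hb i
      omega
    refine ⟨i, hai, hi'.ne', Or.inr ⟨?_, Pi.toLex_update_lt_self_iff.2 hi'⟩⟩
    unfold numOnes
    congr 1
    ext j
    by_cases hji : j = i
    · subst hji
      simp [hone]
    · simp [Function.update_of_ne hji]

end Vectors


/-! ### Existence of labellings. -/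

theorem exists_enumeration {V : Type*} [Finite V] {S : Set V} {t : V} (ht : t ∈ S) :
    ∃ f : ℕ → V, Set.BijOn f (Set.Icc 1 S.ncard) S ∧ f 1 = t := by
  have hpos : 0 < S.ncard := (Set.ncard_pos (Set.toFinite _)).2 ⟨t, ht⟩
  have hcard : (Set.Icc 2 S.ncard).encard = (S \ {t}).encard := by
    rw [← Set.Finite.cast_ncard_eq (Set.toFinite _), ← Set.Finite.cast_ncard_eq (Set.toFinite _),
      Set.ncard_sdiff_singleton_of_mem ht, Set.ncard_eq_toFinset_card']
    simp
  have : Nonempty V := ⟨t⟩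
  obtain ⟨g, hg⟩ := (Set.toFinite (Set.Icc 2 S.ncard)).exists_bijOn_of_encard_eq hcard
  refine ⟨Function.update g 1 t, ?_, by simp⟩
  have hg' : Set.BijOn (Function.update g 1 t) (Set.Icc 2 S.ncard) (S \ {t}) := by
    refine hg.congr fun j hj => ?_
    rw [Function.update_of_ne]
    have := hj.1
    omega
  have h := hg'.insert (a := 1) (by simp)
  have h1 : insert 1 (Set.Icc 2 S.ncard) = Set.Icc 1 S.ncard := by
    ext j
    simp only [Set.mem_insert_iff, Set.mem_Icc]
    omega
  rw [h1, Function.update_self, Set.insert_sdiff_singleton, Set.insert_eq_of_mem ht] at h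
  exact h

theorem IsBalancedThree.nonempty_labelling {V : Type*} [Finite V] {T : SimpleGraph V}
    (hT : IsBalancedThree T) : Nonempty (Labelling T) := by
  let e : Fin (numSupport T) ≃ layer T 1 :=
    (Finite.equivFinOfCardEq (Nat.card_coe_set_eq (layer T 1))).symm
  have : ∀ i, ∃ f : ℕ → V, Set.BijOn f (Set.Icc 1 (deg T (e i))) (T.neighborSet (e i)) ∧
      f 1 ∈ layer T 2 := by
    intro i
    obtain ⟨t, ht, ht2⟩ := hT.exists_two (e i).2
    obtain ⟨f, hf, rfl⟩ := exists_enumeration (S := T.neighborSet (e i)) ht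
    exact ⟨f, hf, ht2⟩
  choose f hf hf2 using this
  refine ⟨⟨fun i => e i, f, ⟨fun i _ => (e i).2, ?_, ?_⟩, hf, hf2⟩⟩
  · intro i _ j _ h
    exact e.injective (Subtype.ext h)
  · intro s hs
    exact ⟨e.symm ⟨s, hs⟩, trivial, by simp⟩

/-! ### Facets as vectors, and the shelling. -/

namespace Labelling

variable {V : Type*} {T : SimpleGraph V} (L : Labelling T)

/-- The set `{u_{1,a_1}, …, u_{p,a_p}}`. -/
def chosen (a : Fin (numSupport T) → ℕ) : Set V := Set.range fun i => L.u i (a i)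

theorem height_s (i) : height T (L.s i) = 1 := L.s_bijOn.mapsTo (Set.mem_univ i)

theorem s_injective : Function.Injective L.s := Set.injOn_univ.1 L.s_bijOn.injOn

variable {L} in
theorem adj_u {i} {j : ℕ} (h1 : 1 ≤ j) (h2 : j ≤ deg T (L.s i)) : T.Adj (L.u i j) (L.s i) :=
  SimpleGraph.Adj.symm ((L.u_bijOn i).mapsTo ⟨h1, h2⟩)

theorem one_le_deg (i) : 1 ≤ deg T (L.s i) := by
  obtain ⟨j, hj, -⟩ : ∃ j ∈ Set.Icc 1 (deg T (L.s i)), True := by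
    by_contra! h
    have h0 : deg T (L.s i) = 0 := by
      by_contra h'
      exact h 1 ⟨le_rfl, by omega⟩
    have := L.height_s i
    simp [height, h0] at this
  exact hj.1.trans hj.2

theorem adj_u_one (i) : T.Adj (L.u i 1) (L.s i) := adj_u le_rfl (L.one_le_deg i)

theorem update_mem_vectors {a b} (ha : a ∈ L.vectors) (hb : b ∈ L.vectors) (i) :
    Function.update a i (b i) ∈ L.vectors := by
  intro j
  by_cases hji : j = i
  · subst hji
    simpa using hb j
  · simpa [Function.update_of_ne hji] using ha j

theorem compl_inter_subset (a b : Fin (numSupport T) → ℕ) (i) :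
    L.compl b ∩ L.compl a ⊆ L.compl (Function.update a i (b i)) := by
  rintro v ⟨hb, ha⟩
  refine ⟨ha.1, ?_⟩
  rintro ⟨j, rfl⟩
  by_cases hji : j = i
  · subst hji
    exact hb.2 ⟨j, by simp⟩
  · exact ha.2 ⟨j, by simp [Function.update_of_ne hji]⟩

theorem compl_update_inter (a b : Fin (numSupport T) → ℕ) (i) :
    L.compl (Function.update a i (b i)) ∩ L.compl a = L.compl a \ {L.u i (b i)} := by
  ext v
  constructor
  · rintro ⟨h, h'⟩
    refine ⟨h', ?_⟩
    rintro rfl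
    exact h.2 ⟨i, by simp⟩
  · rintro ⟨h, h'⟩
    refine ⟨⟨h.1, ?_⟩, h⟩
    rintro ⟨j, rfl⟩
    by_cases hji : j = i
    · subst hji
      simp at h'
    · exact h.2 ⟨j, by simp [Function.update_of_ne hji]⟩

theorem chosen_subset (hT : IsBalancedThree T) {a} (ha : a ∈ L.vectors) : L.chosen a ⊆ evenPart T := by
  rintro _ ⟨i, rfl⟩
  exact hT.even_of_adj_odd (adj_u (ha i).1 (ha i).2) (layer_one_subset (L.height_s i))

section

variable [Finite V] (hT : IsBalancedThree T) (hun : IsUnmixed T)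
include hT hun

theorem index_unique {i i' : Fin (numSupport T)} {j j' : ℕ} (hj : 1 ≤ j)
    (hjd : j ≤ deg T (L.s i)) (hj' : 1 ≤ j') (hjd' : j' ≤ deg T (L.s i'))
    (h : L.u i j = L.u i' j') : i = i' ∧ j = j' := by
  have : i = i' := L.s_injective
    (hT.lower_unique hun (L.height_s i) (L.height_s i') (adj_u hj hjd) (h ▸ adj_u hj' hjd'))
  subst this
  exact ⟨rfl, (L.u_bijOn i).injOn ⟨hj, hjd⟩ ⟨hj', hjd'⟩ h⟩

theorem bijOn_layer_two : Set.BijOn (fun i => L.u i 1) Set.univ (layer T 2) := by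
  refine ⟨fun i _ => L.u_one i, ?_, ?_⟩
  · intro i _ j _ h
    exact (L.index_unique hT hun le_rfl (L.one_le_deg i) le_rfl (L.one_le_deg j) h).1
  · intro v hv
    have hv2 : height T v = 2 := hv
    obtain ⟨s, hs, hs1⟩ := hT.exists_lower (v := v) (by omega)
    obtain ⟨i, -, rfl⟩ := L.s_bijOn.surjOn (show height T s = 1 by omega)
    exact ⟨i, trivial,
      hT.upper_unique hun (L.height_s i) (L.u_one i) hv2 (L.adj_u_one i) hs⟩

/-- The only neighbour of `L.s i` of height two already has index `1`. -/
theorem height_u {i : Fin (numSupport T)} {j : ℕ} (hj : 2 ≤ j) (hjd : j ≤ deg T (L.s i)) :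
    height T (L.u i j) = 0 := by
  have ha : T.Adj (L.u i j) (L.s i) := adj_u (by omega) hjd
  have h := hT.adj_height ha
  rw [L.height_s] at h
  by_contra h0
  have h2 := hT.upper_unique hun (L.height_s i) (L.u_one i)
    (show height T (L.u i j) = 2 by omega) (L.adj_u_one i) ha
  have := (L.index_unique hT hun le_rfl (L.one_le_deg i) (by omega) hjd h2).2
  omega

theorem bijOn_layer_zero (i) : Set.BijOn (L.u i) (Set.Icc 2 (deg T (L.s i)))
    (T.neighborSet (L.s i) ∩ layer T 0) := by
  have hsub : Set.Icc 2 (deg T (L.s i)) ⊆ Set.Icc 1 (deg T (L.s i)) :=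
    Set.Icc_subset_Icc_left (by norm_num)
  refine ⟨fun j hj => ⟨(L.u_bijOn i).mapsTo (hsub hj), L.height_u hT hun hj.1 hj.2⟩,
    (L.u_bijOn i).injOn.mono hsub, ?_⟩
  rintro v ⟨hv, hv0⟩
  obtain ⟨j, hj, rfl⟩ := (L.u_bijOn i).surjOn hv
  refine ⟨j, ⟨?_, hj.2⟩, rfl⟩
  by_contra h
  have hj1 : j = 1 := by
    have := hj.1
    omega
  subst hj1
  have h1 : height T (L.u i 1) = 0 := hv0
  have h2 : height T (L.u i 1) = 2 := L.u_one i
  omega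

theorem u_mem_chosen_iff {a} (ha : a ∈ L.vectors) {i} {j : ℕ} (hj : 1 ≤ j)
    (hjd : j ≤ deg T (L.s i)) : L.u i j ∈ L.chosen a ↔ a i = j := by
  constructor
  · rintro ⟨i', h⟩
    obtain ⟨rfl, h'⟩ := L.index_unique hT hun (ha i').1 (ha i').2 hj hjd h
    exact h'
  · rintro rfl
    exact ⟨i, rfl⟩

theorem ncard_chosen {a} (ha : a ∈ L.vectors) : (L.chosen a).ncard = numSupport T := by
  have : Function.Injective fun i => L.u i (a i) := fun i j h =>
    (L.index_unique hT hun (ha i).1 (ha i).2 (ha j).1 (ha j).2 h).1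
  rw [chosen, ← Set.image_univ, Set.ncard_image_of_injective _ this, Set.ncard_univ, Nat.card_fin]

theorem injOn_compl : Set.InjOn L.compl L.vectors := by
  intro a ha b hb h
  funext i
  have h1 : L.u i (a i) ∈ L.chosen b := by
    by_contra h'
    have h2 : L.u i (a i) ∈ L.compl b :=
      ⟨L.chosen_subset hT ha ⟨i, rfl⟩, h'⟩
    rw [← h] at h2
    exact h2.2 ⟨i, rfl⟩
  exact ((L.u_mem_chosen_iff hT hun hb (ha i).1 (ha i).2).1 h1).symm

theorem nu_compl {a} (ha : a ∈ L.vectors) : L.nu (L.compl a) = a :=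
  (L.injOn_compl hT hun).leftInvOn_invFunOn ha

theorem bijOn_nu : Set.BijOn L.nu L.complSets L.vectors := by
  refine ⟨?_, ?_, fun a ha => ⟨_, ⟨a, ha, rfl⟩, L.nu_compl hT hun ha⟩⟩
  · rintro _ ⟨a, ha, rfl⟩
    rwa [L.nu_compl hT hun ha]
  · rintro _ ⟨a, ha, rfl⟩ _ ⟨b, hb, rfl⟩ h
    rw [L.nu_compl hT hun ha, L.nu_compl hT hun hb] at h
    rw [h]

theorem isStrictTotalOrder_of_subset {S : Set (Set V)} (hS : S ⊆ L.complSets) :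
    IsStrictTotalOrder S fun F F' => L.setLT F F' where
  irrefl F := vecLT_irrefl _
  trans _ _ _ h h' := vecLT_trans h h'
  trichotomous F F' h h' := by
    rcases vecLT_trichotomous (L.nu F) (L.nu F') with h1 | h1 | h1
    · exact absurd h1 h
    · exact Subtype.ext ((L.bijOn_nu hT hun).injOn (hS F.2) (hS F'.2) h1)
    · exact absurd h1 h'

theorem generators_eq : {F | ∃ D, Minimal (IsSTDSet T (oddPart T)) D ∧ F = evenPart T \ D} =
    L.compl '' {a | a ∈ L.vectors ∧ IsSTDSet T (oddPart T) (L.chosen a)} := by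
  ext F
  constructor
  · rintro ⟨D, hD, rfl⟩
    have : ∀ i, ∃ j ∈ Set.Icc 1 (deg T (L.s i)), L.u i j ∈ D := by
      intro i
      obtain ⟨d, hd, hds⟩ := mem_nbhd.1 (hD.1 (layer_one_subset (L.height_s i)))
      obtain ⟨j, hj, rfl⟩ := (L.u_bijOn i).surjOn hds.symm
      exact ⟨j, hj, hd⟩
    choose a ha haD using this
    -- One vertex of `D` near each `s_i` already accounts for all `p` elements of `D`.
    have hchosen : L.chosen a = D := by
      refine Set.eq_of_subset_of_ncard_le ?_ ?_
      · rintro _ ⟨i, rfl⟩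
        exact haD i
      · rw [L.ncard_chosen hT hun ha, hT.ncard_of_minimal hun hD]
    exact ⟨a, ⟨ha, hchosen ▸ hD.1⟩, by rw [← hchosen]; rfl⟩
  · rintro ⟨a, ⟨ha, haD⟩, rfl⟩
    exact ⟨L.chosen a, hT.minimal_of_ncard_le hun haD (L.ncard_chosen hT hun ha).le, rfl⟩

theorem ncard_compl {a} (ha : a ∈ L.vectors) :
    (L.compl a).ncard = (evenPart T).ncard - numSupport T := by
  rw [← L.ncard_chosen hT hun ha]
  exact Set.ncard_sdiff (L.chosen_subset hT ha)

/-- Since `a i ≠ 1`, the removed vertex is a leaf; it dominated only `L.s i`, which its replacement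
dominates too. -/
theorem isSTDSet_update {a b} (ha : a ∈ L.vectors) (hb : b ∈ L.vectors)
    (haD : IsSTDSet T (oddPart T) (L.chosen a)) {i} (hi : a i ≠ 1) :
    IsSTDSet T (oddPart T) (L.chosen (Function.update a i (b i))) := by
  intro x hx
  obtain ⟨_, ⟨j, rfl⟩, hj⟩ := mem_nbhd.1 (haD hx)
  by_cases hji : j = i
  · subst hji
    have h1 := (ha j).1
    have h0 := L.height_u hT hun (by omega) (ha j).2
    have := hT.leaf_unique h0 hj (adj_u (ha j).1 (ha j).2)
    subst this
    exact mem_nbhd.2 ⟨L.u j (b j), ⟨j, by simp⟩, adj_u (hb j).1 (hb j).2⟩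
  · exact mem_nbhd.2 ⟨_, ⟨j, rfl⟩, by simpa [Function.update_of_ne hji] using hj⟩

theorem isShellingOrder_setLT : IsShellingOrder (evenStableComplex T) L.setLT := by
  rw [evenStableComplex, L.generators_eq hT hun]
  have := L.isStrictTotalOrder_of_subset hT hun
    (S := L.compl '' {a | a ∈ L.vectors ∧ IsSTDSet T (oddPart T) (L.chosen a)})
    (Set.image_mono fun _ h => h.1)
  refine isShellingOrder_of_exchange (n := (evenPart T).ncard - numSupport T) ?_ ?_
  · rintro _ ⟨a, ⟨ha, -⟩, rfl⟩
    exact L.ncard_compl hT hun ha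
  · rintro _ ⟨a, ⟨ha, haD⟩, rfl⟩ _ ⟨b, ⟨hb, -⟩, rfl⟩ h
    rw [setLT, L.nu_compl hT hun ha, L.nu_compl hT hun hb] at h
    obtain ⟨i, hi1, hib, hlt⟩ := exists_update_vecLT (fun i => (hb i).1) h
    have hc := L.update_mem_vectors ha hb i
    refine ⟨_, ⟨_, ⟨hc, L.isSTDSet_update hT hun ha hb haD hi1⟩, rfl⟩, ?_,
      L.compl_inter_subset a b i, ?_⟩
    · rwa [setLT, L.nu_compl hT hun ha, L.nu_compl hT hun hc]
    · rw [L.compl_update_inter a b i, ← L.ncard_compl hT hun ha]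
      refine Set.ncard_sdiff_singleton_add_one ⟨L.chosen_subset hT hb ⟨i, rfl⟩, ?_⟩
      exact fun h' => hib ((L.u_mem_chosen_iff hT hun ha (hb i).1 (hb i).2).1 h')

theorem facets_subset_complSets : facets (evenStableComplex T) ⊆ L.complSets := by
  rw [evenStableComplex, L.generators_eq hT hun,
    facets_lowerClosure (n := (evenPart T).ncard - numSupport T)]
  · exact Set.image_mono fun _ h => h.1
  · rintro _ ⟨a, ⟨ha, -⟩, rfl⟩
    exact L.ncard_compl hT hun ha

end

end Labelling

end EvenStable

theorem mainTheorem10 {V : Type*} [Finite V] (T : SimpleGraph V)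
    (hT : T.IsTree) (hbal : EvenStable.IsBalanced T) (hunm : EvenStable.IsUnmixed T)
    (hheight : EvenStable.graphHeight T = 3) :
    Nonempty (EvenStable.Labelling T) ∧
    ∀ L : EvenStable.Labelling T,
      Set.BijOn (fun i => L.u i 1) Set.univ (EvenStable.layer T 2) ∧
      (∀ i, Set.BijOn (L.u i) (Set.Icc 2 (EvenStable.deg T (L.s i)))
        (T.neighborSet (L.s i) ∩ EvenStable.layer T 0)) ∧
      Set.BijOn L.nu L.complSets L.vectors ∧
      (∀ a ∈ L.vectors, L.nu (L.compl a) = a) ∧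
      IsStrictTotalOrder L.complSets (fun F F' => L.setLT F F') ∧
      EvenStable.facets (EvenStable.evenStableComplex T) ⊆ L.complSets ∧
      EvenStable.IsShellingOrder (EvenStable.evenStableComplex T) L.setLT := by
  have h := EvenStable.isBalancedThree hT hbal hheight
  exact ⟨h.nonempty_labelling, fun L => ⟨L.bijOn_layer_two h hunm, L.bijOn_layer_zero h hunm,
    L.bijOn_nu h hunm, fun _ ha => L.nu_compl h hunm ha,
    L.isStrictTotalOrder_of_subset h hunm subset_rfl, L.facets_subset_complSets h hunm,
    L.isShellingOrder_setLT h hunm⟩⟩
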